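/- For $d \ge 1$ and $n \ge 0$ let $\mathcal H_n^d$ be the space of real polynomials $P$ on $\mathbb R^d$ that are homogeneous of degree $n$ and harmonic, i.e. $\Delta P = 0$ with $\Delta = \partial_1^2 + \cdots + \partial_d^2$ (the zero polynomial included). Let $SO(d)$ be the group of real orthogonal $d \times d$ matrices of determinant $1$, and let $T_{n,d}$ be the representation of $SO(d)$ on $\mathcal H_n^d$ given by $(T_{n,d}(Q) f)(x) = f(Q^{-1}x)$. (1) $T_{n,d}$ is irreducible: for all $d \ge 1$ and $n \ge 0$, the only linear subspaces of $\mathcal H_n^d$ that are invariant under $T_{n,d}(Q)$ for all $Q \in SO(d)$ are $\{0\}$ and $\mathcal H_n^d$. For $d \ge 2$ the space $\mathcal H_n^d$ is moreover nonzero. (2) Let $d \ge 3$, $n \ge 0$ and $\lambda = \frac{d-2}{2}$, and let $$C_n^\lambda(t) = \frac{(\lambda)_n 2^n}{n!}\, t^n\, {}_2F_1\Big(-\tfrac n2, \tfrac{1-n}{2}; 1-n-\lambda; \tfrac1{t^2}\Big) = \frac{(\lambda)_n 2^n}{n!} \sum_{0 \le j \le n/2} \frac{(-\frac n2)_j (\frac{1-n}2)_j}{j!\,(1-n-\lambda)_j}\,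 t^{n-2j}$$ be the Gegenbauer polynomial, where $(a)_j = a(a+1)\cdots(a+j-1)$. Then the function $x \mapsto \|x\|^n C_n^\lambda(x_d/\|x\|)$, $x \ne 0$, is given by an element of $\mathcal H_n^d$, and an element $Y \in \mathcal H_n^d$ satisfies $T_{n,d}(Q) Y = Y$ for every $Q \in SO(d)$ with $Q e_d = e_d$, where $e_d = (0,\ldots,0,1)$, if and only if there is a constant $c \in \mathbb R$ with $$Y(x) = c\, \|x\|^n\, C_n^\lambda\Big(\frac{x_d}{\|x\|}\Big) \qquad \text{for all } x \ne 0.$$ -/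

import Mathlib

open scoped Nat

noncomputable section

namespace SphericalHarmonics

open MvPolynomial

/-- The Laplace operator `∂₁² + ⋯ + ∂_d²` on real polynomials in `d` variables. -/
def laplacian (d : ℕ) : MvPolynomial (Fin d) ℝ →ₗ[ℝ] MvPolynomial (Fin d) ℝ :=
  ∑ i : Fin d, (pderiv i).toLinearMap ∘ₗ (pderiv i).toLinearMap

/-- The space of real harmonic polynomials on `ℝ^d` that are homogeneous of degree `n`. -/
def harmonics (d n : ℕ) : Submodule ℝ (MvPolynomial (Fin d) ℝ) :=
  homogeneousSubmodule (Fin d) ℝ n ⊓ LinearMap.ker (laplacian d)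

/-- The polynomial `x ↦ f (A x)` for a square matrix `A`. -/
def compMatrix {d : ℕ} (A : Matrix (Fin d) (Fin d) ℝ) :
    MvPolynomial (Fin d) ℝ →ₐ[ℝ] MvPolynomial (Fin d) ℝ :=
  bind₁ A.toMvPolynomial

theorem eval_compMatrix {d : ℕ} (A : Matrix (Fin d) (Fin d) ℝ) (f : MvPolynomial (Fin d) ℝ)
    (x : Fin d → ℝ) : eval x (compMatrix A f) = eval (A.mulVec x) f := by
  have h : (eval x : MvPolynomial (Fin d) ℝ →+* ℝ) = eval₂Hom (RingHom.id ℝ) x := rfl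
  rw [h, compMatrix, eval₂Hom_bind₁]
  have h2 : (fun i => eval₂Hom (RingHom.id ℝ) x (A.toMvPolynomial i)) = A.mulVec x := by
    funext i
    exact A.toMvPolynomial_eval_eq_apply i x
  rw [h2]
  rfl

theorem compMatrix_one {d : ℕ} (f : MvPolynomial (Fin d) ℝ) : compMatrix 1 f = f := by
  simp [compMatrix]

theorem compMatrix_mul {d : ℕ} (A B : Matrix (Fin d) (Fin d) ℝ) (f : MvPolynomial (Fin d) ℝ) :
    compMatrix (A * B) f = compMatrix B (compMatrix A f) := by
  rw [compMatrix, compMatrix, compMatrix, bind₁_bind₁]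
  congr 2
  funext i
  exact Matrix.toMvPolynomial_mul A B i

theorem pderiv_compMatrix {d : ℕ} (A : Matrix (Fin d) (Fin d) ℝ) (i : Fin d)
    (f : MvPolynomial (Fin d) ℝ) :
    pderiv i (compMatrix A f) = ∑ j, A j i • compMatrix A (pderiv j f) := by
  induction f using MvPolynomial.induction_on with
  | C a => simp [compMatrix]
  | add p q hp hq => simp [hp, hq, Finset.sum_add_distrib]
  | mul_X p k hp =>
    have hX : pderiv i (compMatrix A (X k)) = C (A k i) := by
      simp [compMatrix, Matrix.toMvPolynomial, pderiv_monomial, Finsupp.single_apply,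
        apply_ite, Finset.sum_ite_eq']
    rw [map_mul, Derivation.leibniz, hp, hX]
    simp only [Derivation.leibniz, pderiv_X, smul_eq_mul, map_add, map_mul, Pi.single_apply,
      smul_add, Finset.sum_add_distrib]
    congr 1
    · rw [Finset.sum_eq_single k]
      · simp [MvPolynomial.smul_eq_C_mul, mul_comm]
      · intro b _ hb
        simp [hb.symm]
      · simp
    · rw [Finset.mul_sum]
      exact Finset.sum_congr rfl fun j _ => by rw [mul_smul_comm]

theorem laplacian_compMatrix {d : ℕ} (A : Matrix (Fin d) (Fin d) ℝ) (hA : A * A.transpose = 1)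
    (f : MvPolynomial (Fin d) ℝ) :
    laplacian d (compMatrix A f) = compMatrix A (laplacian d f) := by
  have h (j k : Fin d) : ∑ i, A j i * A k i = if j = k then 1 else 0 := by
    have := congrFun (congrFun hA j) k
    simpa [Matrix.mul_apply, Matrix.one_apply] using this
  simp only [laplacian, LinearMap.sum_apply, LinearMap.comp_apply, Derivation.coeFn_coe, pderiv_compMatrix, map_sum, Derivation.map_smul, Finset.smul_sum,
    smul_smul]
  rw [Finset.sum_comm]
  refine Finset.sum_congr rfl fun j _ => ?_
  rw [Finset.sum_comm]
  simp_rw [← Finset.sum_smul, h]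
  simp

theorem compMatrix_mem_harmonics {d n : ℕ} (A : Matrix (Fin d) (Fin d) ℝ)
    (hA : A * A.transpose = 1) {f : MvPolynomial (Fin d) ℝ} (hf : f ∈ harmonics d n) :
    compMatrix A f ∈ harmonics d n := by
  obtain ⟨h1, h2⟩ := hf
  refine ⟨?_, ?_⟩
  · have := (show f.IsHomogeneous n from h1).aeval A.toMvPolynomial
      (fun i => A.toMvPolynomial_isHomogeneous i)
    rw [one_mul] at this
    exact this
  · change laplacian d (compMatrix A f) = 0
    rw [laplacian_compMatrix A hA, show laplacian d f = 0 from h2, map_zero]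

theorem mul_transpose_of_mem {d : ℕ} (Q : Matrix.specialOrthogonalGroup (Fin d) ℝ) :
    (Q : Matrix (Fin d) (Fin d) ℝ) * (Q : Matrix (Fin d) (Fin d) ℝ).transpose = 1 :=
  Matrix.mem_orthogonalGroup_iff (Fin d) ℝ |>.1 (Matrix.mem_specialOrthogonalGroup_iff.1 Q.2).1

/-- The representation of `SO(d)` on the harmonic polynomials of degree `n`,
`(T(Q) f)(x) = f (Q⁻¹ x)`. -/
def harmonicRep (d n : ℕ) :
    Representation ℝ (Matrix.specialOrthogonalGroup (Fin d) ℝ) (harmonics d n) where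
  toFun Q := (compMatrix ((Q⁻¹ : Matrix.specialOrthogonalGroup (Fin d) ℝ) :
      Matrix (Fin d) (Fin d) ℝ)).toLinearMap.restrict
    fun _ hf => compMatrix_mem_harmonics _ (mul_transpose_of_mem Q⁻¹) hf
  map_one' := by
    ext1 f
    apply Subtype.ext
    simp [LinearMap.restrict_apply, compMatrix_one]
  map_mul' P Q := by
    ext1 f
    apply Subtype.ext
    simp only [mul_inv_rev, Submonoid.coe_mul, LinearMap.coe_restrict_apply,
      AlgHom.toLinearMap_apply, compMatrix_mul, Module.End.mul_apply]
    rfl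

theorem eval_harmonicRep (d n : ℕ) (Q : Matrix.specialOrthogonalGroup (Fin d) ℝ)
    (f : harmonics d n) (x : Fin d → ℝ) :
    eval x (harmonicRep d n Q f : MvPolynomial (Fin d) ℝ) =
      eval (((Q⁻¹ : Matrix.specialOrthogonalGroup (Fin d) ℝ) :
        Matrix (Fin d) (Fin d) ℝ).mulVec x) (f : MvPolynomial (Fin d) ℝ) :=
  eval_compMatrix _ _ _

/-- The Gegenbauer polynomial
`C_n^lam (t) = (lam)_n 2^n / n! * t^n * ₂F₁(-n/2, (1-n)/2; 1-n-lam; 1/t²)`,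
written out as a polynomial in `t`: the hypergeometric series ends at `j = ⌊n/2⌋`. -/
def gegenbauer (n : ℕ) (lam : ℝ) : Polynomial ℝ :=
  ∑ j ∈ Finset.range (n / 2 + 1),
    Polynomial.monomial (n - 2 * j)
      ((ascPochhammer ℝ n).eval lam * 2 ^ n / (n ! : ℝ) *
        ((ascPochhammer ℝ j).eval (-(n : ℝ) / 2) * (ascPochhammer ℝ j).eval ((1 - (n : ℝ)) / 2) /
          ((ascPochhammer ℝ j).eval (1 - (n : ℝ) - lam) * (j ! : ℝ))))

end SphericalHarmonics

end

/-!
The Fischer form `⟨f, g⟩ = f(∂) g (0)` is positive definite, invariant under orthogonal changes of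
variables, and makes multiplication by `|x|²` adjoint to the Laplacian.

Call a polynomial zonal if its value at `x` depends only on `x_k` and `|x|`. A homogeneous zonal `f`
is a combination of products `(|x|² - x_k²)^j x_k^(n-2j)`. If `f` is also harmonic, then pairing
with `f` annihilates the multiples of `|x|²`, so `⟨f, f⟩` is a multiple of `⟨x_k^n, f⟩`, that is, of
`f(e_k)`. Hence a zonal harmonic that vanishes at `e_k` is zero, and any two zonal harmonics are
proportional.

In a nonzero invariant subspace `U`, the element representing evaluation at `e_k` is nonzero and
zonal. If `U` were proper, its orthogonal complement would contain a nonzero zonal harmonic as well,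
which would be both proportional and orthogonal to the one in `U`.

For `d ≥ 3` the rotations fixing `e_k` act transitively on the points of given length and given
`k`-th coordinate, so the harmonics they fix are the zonal ones, that is, the multiples of the
homogenized Gegenbauer polynomial, whose coefficients satisfy the recurrence that `Δ = 0` imposes.
This polynomial is nonzero because it takes the value of its leading coefficient at an isotropic
complex point with `k`-th coordinate `1`.
-/

noncomputable section

namespace SphericalHarmonics

open MvPolynomial Matrix

section Rotations

variable {ι κ K : Type*} [Fintype ι]

section Field

variable [Field K]

theorem exists_ne_zero_forall_dotProduct_eq_zero [Fintype κ]
    (hcard : Fintype.card κ < Fintype.card ι) (w : κ → ι → K) :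
    ∃ v ≠ 0, ∀ i, w i ⬝ᵥ v = 0 := by
  have hker : LinearMap.ker (Matrix.of w).mulVecLin ≠ ⊥ :=
    LinearMap.ker_ne_bot_of_finrank_lt (by simpa only [Module.finrank_fintype_fun_eq_card])
  obtain ⟨v, hv, hv0⟩ := Submodule.exists_mem_ne_zero_of_ne_bot hker
  exact ⟨v, hv0, congrFun hv⟩

variable [DecidableEq ι]

/-- The reflection in the hyperplane orthogonal to `v`, the building block of all rotations used
below. For an isotropic `v`, such as `v = 0`, it is the identity, because `2 / 0 = 0`. -/
def householder (v : ι → K) : Matrix ι ι K :=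
  1 - (2 / (v ⬝ᵥ v)) • vecMulVec v v

theorem householder_mulVec (v w : ι → K) :
    householder v *ᵥ w = w - (2 / (v ⬝ᵥ v) * (v ⬝ᵥ w)) • v := by
  rw [householder, sub_mulVec, one_mulVec, smul_mulVec, vecMulVec_mulVec, op_smul_eq_smul,
    smul_smul]

theorem householder_mulVec_of_dotProduct_eq_zero {v w : ι → K} (h : v ⬝ᵥ w = 0) :
    householder v *ᵥ w = w := by
  rw [householder_mulVec, h, mul_zero, zero_smul, sub_zero]

theorem householder_mem_orthogonalGroup (v : ι → K) :
    householder v ∈ orthogonalGroup ι K := by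
  have transpose_eq : (householder v)ᵀ = householder v := by
    rw [householder, transpose_sub, transpose_one, transpose_smul, transpose_vecMulVec]
  have mul_self : vecMulVec v v * vecMulVec v v = (v ⬝ᵥ v) • vecMulVec v v := by
    rw [vecMulVec_mul_vecMulVec, vecMulVec_smul]
  have coeff_eq_zero : 2 * (2 / (v ⬝ᵥ v)) - (2 / (v ⬝ᵥ v)) ^ 2 * (v ⬝ᵥ v) = 0 := by
    field_simp
    ring
  rw [mem_orthogonalGroup_iff, transpose_eq]
  calc householder v * householder v
      = 1 - (2 * (2 / (v ⬝ᵥ v)) - (2 / (v ⬝ᵥ v)) ^ 2 * (v ⬝ᵥ v)) • vecMulVec v v := by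
        simp only [householder, sub_mul, mul_sub, one_mul, mul_one, smul_mul_assoc,
          mul_smul_comm, mul_self]
        module
    _ = 1 := by rw [coeff_eq_zero, zero_smul, sub_zero]

theorem det_householder {v : ι → K} (hv : v ⬝ᵥ v ≠ 0) : (householder v).det = -1 := by
  have h := det_one_add_replicateCol_mul_replicateRow (ι := Unit) (-(2 / (v ⬝ᵥ v)) • v) v
  rw [← vecMulVec_eq Unit, smul_vecMulVec, neg_smul, ← sub_eq_add_neg, dotProduct_smul,
    smul_eq_mul, neg_mul, div_mul_cancel₀ _ hv] at h
  rw [householder, h]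
  ring

end Field

section OrderedField

variable [DecidableEq ι] [Field K] [LinearOrder K] [IsStrictOrderedRing K]

theorem householder_sub_mulVec {x y : ι → K} (h : x ⬝ᵥ x = y ⬝ᵥ y) :
    householder (x - y) *ᵥ x = y := by
  obtain rfl | hxy := eq_or_ne x y
  · rw [sub_self, householder_mulVec, smul_zero, sub_zero]
  have hne : (x - y) ⬝ᵥ (x - y) ≠ 0 := by
    rwa [Ne, dotProduct_self_eq_zero, sub_eq_zero]
  have hdouble : (x - y) ⬝ᵥ (x - y) = 2 * ((x - y) ⬝ᵥ x) := by
    simp only [sub_dotProduct, dotProduct_sub, dotProduct_comm y x]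
    linear_combination -h
  have hscale : 2 / ((x - y) ⬝ᵥ (x - y)) * ((x - y) ⬝ᵥ x) = 1 := by
    rw [div_mul_eq_mul_div, ← hdouble, div_self hne]
  rw [householder_mulVec, hscale, one_smul, sub_sub_cancel]

theorem householder_sub_mulVec' {x y : ι → K} (h : x ⬝ᵥ x = y ⬝ᵥ y) :
    householder (x - y) *ᵥ y = x := by
  have hneg : householder (x - y) = householder (y - x) := by
    rw [← neg_sub y x, householder, householder, neg_dotProduct_neg, neg_vecMulVec,
      vecMulVec_neg, neg_neg]
  rw [hneg, householder_sub_mulVec h.symm]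

theorem householder_mul_householder_mem {v w : ι → K} (hv : v ≠ 0) (hw : w ≠ 0) :
    householder v * householder w ∈ specialOrthogonalGroup ι K := by
  refine mem_specialOrthogonalGroup_iff.2 ⟨mul_mem (householder_mem_orthogonalGroup v)
    (householder_mem_orthogonalGroup w), ?_⟩
  rw [det_mul, det_householder (dotProduct_self_eq_zero.not.2 hv),
    det_householder (dotProduct_self_eq_zero.not.2 hw), neg_mul_neg, one_mul]

theorem exists_rotation [Fintype κ] (hcard : Fintype.card κ + 1 < Fintype.card ι)
    (w : κ → ι → K) {x y : ι → K} (h : x ⬝ᵥ x = y ⬝ᵥ y) (hw : ∀ i, w i ⬝ᵥ x = w i ⬝ᵥ y) :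
    ∃ Q : specialOrthogonalGroup ι K,
      (Q : Matrix ι ι K) *ᵥ x = y ∧ ∀ i, (Q : Matrix ι ι K) *ᵥ w i = w i := by
  obtain rfl | hxy := eq_or_ne x y
  · exact ⟨1, one_mulVec x, fun i => one_mulVec (w i)⟩
  obtain ⟨v, hv, hvw⟩ := exists_ne_zero_forall_dotProduct_eq_zero
    (by rwa [Fintype.card_option]) (fun o : Option κ => o.elim y w)
  have fix_y : householder v *ᵥ y = y :=
    householder_mulVec_of_dotProduct_eq_zero ((dotProduct_comm v y).trans (hvw none))
  have fix_w (i : κ) : householder v *ᵥ w i = w i :=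
    householder_mulVec_of_dotProduct_eq_zero ((dotProduct_comm v (w i)).trans (hvw (some i)))
  have fix_w' (i : κ) : householder (x - y) *ᵥ w i = w i :=
    householder_mulVec_of_dotProduct_eq_zero
      (by rw [dotProduct_comm, dotProduct_sub, hw, sub_self])
  -- The reflection along `x - y` moves `x` to `y`; the one along `v` only corrects its determinant.
  refine ⟨⟨_, householder_mul_householder_mem hv (sub_ne_zero.2 hxy)⟩, ?_, fun i => ?_⟩
  · rw [← mulVec_mulVec, householder_sub_mulVec h, fix_y]
  · rw [← mulVec_mulVec, fix_w', fix_w]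

theorem exists_rotation_swap {e x y : ι → K} (hx : e ⬝ᵥ e = x ⬝ᵥ x) (hy : e ⬝ᵥ e = y ⬝ᵥ y)
    (he : e ⬝ᵥ x = e ⬝ᵥ y) (hxy : x ≠ y) :
    ∃ Q : specialOrthogonalGroup ι K,
      (Q : Matrix ι ι K) *ᵥ e = y ∧ (Q : Matrix ι ι K) *ᵥ x = e := by
  have hey : e ≠ y := by
    rintro rfl
    refine hxy (sub_eq_zero.1 (dotProduct_self_eq_zero.1 ?_))
    rw [sub_dotProduct, dotProduct_sub, dotProduct_sub, dotProduct_comm x e, he, ← hx, sub_self]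
  have fix_e : householder (x - y) *ᵥ e = e :=
    householder_mulVec_of_dotProduct_eq_zero
      (by rw [dotProduct_comm, dotProduct_sub, he, sub_self])
  refine ⟨⟨_, householder_mul_householder_mem (sub_ne_zero.2 hey) (sub_ne_zero.2 hxy)⟩, ?_, ?_⟩
  · rw [← mulVec_mulVec, fix_e, householder_sub_mulVec hy]
  · rw [← mulVec_mulVec, householder_sub_mulVec (hx.symm.trans hy), householder_sub_mulVec' hy]

end OrderedField

section CommRing

variable {R : Type*} [DecidableEq ι] [CommRing R] (Q : specialOrthogonalGroup ι R)

theorem coe_inv_eq_transpose :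
    ((Q⁻¹ : specialOrthogonalGroup ι R) : Matrix ι ι R) = (Q : Matrix ι ι R)ᵀ :=
  rfl

theorem inv_mulVec_mulVec (x : ι → R) :
    ((Q⁻¹ : specialOrthogonalGroup ι R) : Matrix ι ι R) *ᵥ ((Q : Matrix ι ι R) *ᵥ x) = x := by
  rw [mulVec_mulVec, ← Submonoid.coe_mul, inv_mul_cancel, OneMemClass.coe_one, one_mulVec]

theorem mulVec_dotProduct_mulVec (x y : ι → R) :
    ((Q : Matrix ι ι R) *ᵥ x) ⬝ᵥ ((Q : Matrix ι ι R) *ᵥ y) = x ⬝ᵥ y := by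
  rw [dotProduct_mulVec, vecMul_mulVec, ← coe_inv_eq_transpose, ← Submonoid.coe_mul,
    inv_mul_cancel, OneMemClass.coe_one, vecMul_one]

end CommRing

end Rotations

section AnisotropicForm

variable {K V : Type*} [Field K] [AddCommGroup V] [Module K V] {B : LinearMap.BilinForm K V}

theorem exists_mem_forall_apply_eq (hB : ∀ v, B v v = 0 → v = 0) (U : Submodule K V)
    [FiniteDimensional K U] (ℓ : Module.Dual K V) : ∃ u ∈ U, ∀ v ∈ U, B u v = ℓ v := by
  have injective : Function.Injective (B.domRestrict₁₂ U U) := by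
    rw [← LinearMap.ker_eq_bot, LinearMap.ker_eq_bot']
    exact fun u hu => Subtype.ext (hB u (LinearMap.congr_fun hu u))
  obtain ⟨u, hu⟩ := (LinearMap.injective_iff_surjective_of_finrank_eq_finrank
    Subspace.dual_finrank_eq.symm).1 injective (ℓ.domRestrict U)
  exact ⟨u, u.2, fun v hv => LinearMap.congr_fun hu ⟨v, hv⟩⟩

theorem isCompl_orthogonal_of_anisotropic [FiniteDimensional K V] (hrefl : B.IsRefl)
    (hB : ∀ v, B v v = 0 → v = 0) (U : Submodule K V) : IsCompl U (B.orthogonal U) :=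
  (LinearMap.BilinForm.isCompl_orthogonal_iff_disjoint hrefl).2
    (Submodule.disjoint_def.2 fun v hv hv' => hB v (hv' v hv))

end AnisotropicForm

section Homogeneous

variable {σ R : Type*} [CommSemiring R] {n : ℕ} {f : MvPolynomial σ R}

theorem eval_smul_of_isHomogeneous (hf : f.IsHomogeneous n) (s : R) (x : σ → R) :
    eval (s • x) f = s ^ n * eval x f := by
  rw [eval_eq, eval_eq, Finset.mul_sum]
  refine Finset.sum_congr rfl fun α hα => ?_
  have hdeg : n = ∑ i ∈ α.support, α i := hf.degree_eq_sum_deg_support hα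
  simp only [Pi.smul_apply, smul_eq_mul, mul_pow, Finset.prod_mul_distrib,
    Finset.prod_pow_eq_pow_sum, ← hdeg]
  ring

theorem eval_single_of_isHomogeneous [DecidableEq σ] (hf : f.IsHomogeneous n) (k : σ) :
    eval (Pi.single k 1) f = coeff (Finsupp.single k n) f := by
  rw [eval_eq, Finset.sum_eq_single (Finsupp.single k n)]
  · rw [Finset.prod_eq_one, mul_one]
    intro i hi
    rw [Finset.mem_singleton.1 (Finsupp.support_single_subset hi), Pi.single_eq_same, one_pow]
  · intro α hα hne
    obtain ⟨i, hi, hik⟩ : ∃ i ∈ α.support, i ≠ k := by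
      by_contra! hsupp
      obtain ⟨m, rfl⟩ := Finsupp.support_subset_singleton'.1
        fun i hi => Finset.mem_singleton.2 (hsupp i hi)
      exact hne (by
        rw [hf.degree_eq_sum_deg_support hα, ← Finsupp.degree_apply, Finsupp.degree_single])
    rw [Finset.prod_eq_zero hi, mul_zero]
    rw [Pi.single_eq_of_ne hik, zero_pow (Finsupp.mem_support_iff.1 hi)]
  · intro h
    rw [notMem_support_iff.1 h, zero_mul]

theorem eq_zero_of_subsingleton {σ R : Type*} [DecidableEq σ] [Subsingleton σ] [CommRing R]
    [IsDomain R] [Infinite R] {n : ℕ} {k : σ} {f : MvPolynomial σ R} (hf : f.IsHomogeneous n)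
    (h : eval (Pi.single k 1) f = 0) : f = 0 := by
  refine MvPolynomial.funext fun x => ?_
  have hx : x = x k • Pi.single k 1 := by
    ext j
    rw [Subsingleton.elim j k, Pi.smul_apply, Pi.single_eq_same, smul_eq_mul, mul_one]
  rw [hx, eval_smul_of_isHomogeneous hf, h, mul_zero, map_zero]

theorem eq_of_forall_ne_zero_eval_eq {σ R : Type*} [Finite σ] [Nonempty σ] [CommRing R]
    [IsDomain R] [Infinite R] {f g : MvPolynomial σ R}
    (h : ∀ x : σ → R, x ≠ 0 → eval x f = eval x g) : f = g := by
  refine MvPolynomial.funext_set (fun _ => {0}ᶜ)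
    (fun _ => (Set.finite_singleton 0).infinite_compl) fun x hx => h x ?_
  rintro rfl
  exact hx (Classical.arbitrary σ) trivial rfl

end Homogeneous

section RotationOrbits

variable {ι : Type*} [Fintype ι] [DecidableEq ι] {n : ℕ} {k : ι} {f : MvPolynomial ι ℝ}

theorem sqrt_smul_single_dotProduct_self (k : ι) (x : ι → ℝ) :
    (√(x ⬝ᵥ x) • Pi.single k 1 : ι → ℝ) ⬝ᵥ (√(x ⬝ᵥ x) • Pi.single k 1) = x ⬝ᵥ x := by
  have nonneg : 0 ≤ x ⬝ᵥ x := Finset.sum_nonneg fun i _ => mul_self_nonneg (x i)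
  rw [smul_dotProduct, dotProduct_smul, single_one_dotProduct, Pi.single_eq_same, smul_eq_mul,
    smul_eq_mul, mul_one, Real.mul_self_sqrt nonneg]

theorem eq_zero_of_forall_eval_rotation (hf : f.IsHomogeneous n)
    (h : ∀ Q : specialOrthogonalGroup ι ℝ,
      eval ((Q : Matrix ι ι ℝ) *ᵥ Pi.single k 1) f = 0) : f = 0 := by
  cases subsingleton_or_nontrivial ι with
  | inl _ =>
    exact eq_zero_of_subsingleton hf (by simpa only [OneMemClass.coe_one, one_mulVec] using h 1)
  | inr _ =>
    refine MvPolynomial.funext fun x => ?_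
    obtain ⟨Q, hQ, -⟩ := exists_rotation (κ := Empty)
      (by simpa using Fintype.one_lt_card (α := ι)) Empty.elim
      (sqrt_smul_single_dotProduct_self k x) Empty.rec
    rw [← hQ, mulVec_smul, eval_smul_of_isHomogeneous hf, h, mul_zero, map_zero]

end RotationOrbits

section NormSq

variable {σ R : Type*} [CommSemiring R]

/-- The squared length `∑ᵢ Xᵢ²` as a polynomial. Multiplication by it is adjoint to the Laplacian
for the Fischer form. -/
def normSqPoly (σ R : Type*) [Fintype σ] [CommSemiring R] : MvPolynomial σ R :=
  ∑ i, X i ^ 2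

theorem isHomogeneous_normSqPoly [Fintype σ] : (normSqPoly σ R).IsHomogeneous 2 :=
  IsHomogeneous.sum _ _ _ fun i _ => isHomogeneous_X_pow i 2

theorem eval_normSqPoly [Fintype σ] (x : σ → R) : eval x (normSqPoly σ R) = x ⬝ᵥ x := by
  simp only [normSqPoly, map_sum, map_pow, eval_X, dotProduct, ← pow_two]

theorem pderiv_normSqPoly [Fintype σ] (i : σ) :
    pderiv i (normSqPoly σ R) = 2 * X i := by
  classical
  simp [normSqPoly, pderiv_X, Pi.single_apply]

end NormSq

section Fischer

variable {σ R : Type*} [CommSemiring R]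

/-- The Fischer form on polynomials, for which the monomials are orthogonal and `X ^ α` has square
length `α!`. Multiplication by `X i` is adjoint to the derivative `∂ᵢ`. -/
def fischer : LinearMap.BilinForm R (MvPolynomial σ R) :=
  (basisMonomials σ R).constr R fun α => (α.prod fun _ m => (m ! : R)) • lcoeff R α

theorem fischer_monomial (α : σ →₀ ℕ) (a : R) (g : MvPolynomial σ R) :
    fischer (monomial α a) g = a * (α.prod fun _ m => (m ! : R)) * coeff α g := by
  have h : monomial α a = a • basisMonomials σ R α := by
    rw [coe_basisMonomials, smul_monomial, smul_eq_mul, mul_one]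
  rw [h, map_smul, fischer, Module.Basis.constr_basis, LinearMap.smul_apply, LinearMap.smul_apply,
    lcoeff_apply, smul_eq_mul, smul_eq_mul, mul_assoc]

theorem fischer_apply (f g : MvPolynomial σ R) :
    fischer f g = ∑ α ∈ f.support, coeff α f * (α.prod fun _ m => (m ! : R)) * coeff α g := by
  conv_lhs => rw [f.as_sum]
  simp only [map_sum, LinearMap.sum_apply, fischer_monomial]

theorem fischer_isSymm : (fischer : LinearMap.BilinForm R (MvPolynomial σ R)).IsSymm := by
  classical
  refine ⟨fun f g => ?_⟩
  induction f using MvPolynomial.induction_on' with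
  | add p q hp hq => simp only [map_add, LinearMap.add_apply, hp, hq] at *
  | monomial α a =>
    induction g using MvPolynomial.induction_on' with
    | add p q hp hq => simp only [map_add, LinearMap.add_apply, hp, hq] at *
    | monomial β b =>
      simp only [fischer_monomial, coeff_monomial]
      obtain rfl | h := eq_or_ne α β
      · simp only [if_true]
        ring
      · simp only [h, h.symm, if_false, mul_zero]

theorem fischer_X_mul (i : σ) (f g : MvPolynomial σ R) :
    fischer (X i * f) g = fischer f (pderiv i g) := by
  classical
  induction f using MvPolynomial.induction_on' with
  | add p q hp hq => simp only [mul_add, map_add, LinearMap.add_apply, hp, hq]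
  | monomial α a =>
    have factorial_succ : (α + Finsupp.single i 1).prod (fun _ m => (m ! : R)) =
        (α i + 1) * α.prod fun _ m => (m ! : R) := by
      rw [← Finsupp.mul_prod_erase' (α + Finsupp.single i 1) i _ (by simp),
        ← Finsupp.mul_prod_erase' α i _ (by simp), Finsupp.erase_add, Finsupp.erase_single,
        add_zero, Finsupp.add_apply, Finsupp.single_eq_same, Nat.factorial_succ, Nat.cast_mul,
        Nat.cast_succ, mul_assoc]
    rw [mul_comm, X, monomial_mul, mul_one, fischer_monomial, fischer_monomial, coeff_pderiv,
      factorial_succ]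
    ring

theorem fischer_X_pow [DecidableEq σ] {n : ℕ} {f : MvPolynomial σ R} (hf : f.IsHomogeneous n)
    (k : σ) : fischer (X k ^ n) f = n ! * eval (Pi.single k 1) f := by
  rw [eval_single_of_isHomogeneous hf, X_pow_eq_monomial, fischer_monomial,
    Finsupp.prod_single_index (by rw [Nat.factorial_zero, Nat.cast_one]), one_mul]

theorem eq_zero_of_fischer_self {K : Type*} [Field K] [LinearOrder K] [IsStrictOrderedRing K]
    {f : MvPolynomial σ K} (h : fischer f f = 0) : f = 0 := by
  have weight_pos (α : σ →₀ ℕ) : 0 < α.prod fun _ m => (m ! : K) :=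
    Finset.prod_pos fun i _ => Nat.cast_pos.2 (Nat.factorial_pos (α i))
  rw [fischer_apply, Finset.sum_eq_zero_iff_of_nonneg] at h
  · by_contra hf
    obtain ⟨α, hα⟩ := support_nonempty.2 hf
    have hcoeff : coeff α f ≠ 0 := mem_support_iff.1 hα
    exact mul_ne_zero (mul_ne_zero hcoeff (weight_pos α).ne') hcoeff (h α hα)
  · intro α _
    rw [mul_right_comm]
    exact mul_nonneg (mul_self_nonneg _) (weight_pos α).le

variable {d : ℕ}

theorem fischer_normSqPoly_mul (f g : MvPolynomial (Fin d) ℝ) :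
    fischer (normSqPoly (Fin d) ℝ * f) g = fischer f (laplacian d g) := by
  simp only [normSqPoly, laplacian, Finset.sum_mul, map_sum, LinearMap.sum_apply, pow_two,
    mul_assoc, fischer_X_mul, LinearMap.comp_apply, Derivation.coeFn_coe]

theorem compMatrix_C (A : Matrix (Fin d) (Fin d) ℝ) (a : ℝ) : compMatrix A (C a) = C a :=
  algHom_C _ a

theorem compMatrix_X (A : Matrix (Fin d) (Fin d) ℝ) (k : Fin d) :
    compMatrix A (X k) = ∑ j, A k j • X j := by
  simp only [compMatrix, bind₁_X_right, Matrix.toMvPolynomial, smul_eq_C_mul,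
    C_mul_X_eq_monomial]

theorem fischer_compMatrix (A : Matrix (Fin d) (Fin d) ℝ) (f g : MvPolynomial (Fin d) ℝ) :
    fischer (compMatrix A f) g = fischer f (compMatrix Aᵀ g) := by
  induction f using MvPolynomial.induction_on generalizing g with
  | C a =>
    have coeff_zero : coeff 0 (compMatrix Aᵀ g) = coeff 0 g := by
      rw [← constantCoeff_eq, ← eval_zero, eval_compMatrix, mulVec_zero]
    rw [compMatrix_C, ← monomial_zero', fischer_monomial, fischer_monomial, coeff_zero]
  | add p q hp hq => simp only [map_add, LinearMap.add_apply, hp, hq]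
  | mul_X p k hp =>
    rw [map_mul, compMatrix_X, mul_comm, mul_comm p, fischer_X_mul, pderiv_compMatrix,
      Finset.sum_mul]
    simp only [map_sum, LinearMap.sum_apply, smul_mul_assoc, map_smul, LinearMap.smul_apply,
      fischer_X_mul, hp, Matrix.transpose_apply]

end Fischer

section Laplacian

variable {d m : ℕ} {f : MvPolynomial (Fin d) ℝ}

theorem laplacian_X_pow (k : Fin d) (m : ℕ) :
    laplacian d (X k ^ m) = ((m : ℝ) * (m - 1)) • X k ^ (m - 2) := by
  simp only [laplacian, LinearMap.sum_apply, LinearMap.comp_apply, Derivation.coeFn_coe]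
  rw [Finset.sum_eq_single k]
  · cases m with
    | zero => simp
    | succ m =>
      simp only [pderiv_pow, pderiv_X_self, pderiv_mul, mul_one, Nat.add_sub_cancel,
        ← Nat.sub_sub (m + 1) 1 1]
      simp [smul_eq_C_mul, mul_assoc]
  · intro i _ hi
    simp [pderiv_X_of_ne hi.symm]
  · simp

theorem laplacian_normSqPoly_mul (hf : f.IsHomogeneous m) :
    laplacian d (normSqPoly (Fin d) ℝ * f) =
      normSqPoly (Fin d) ℝ * laplacian d f + (4 * m + 2 * d : ℝ) • f := by
  have second_pderiv (i : Fin d) : pderiv i (pderiv i (normSqPoly (Fin d) ℝ * f)) =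
      normSqPoly (Fin d) ℝ * pderiv i (pderiv i f) + 4 * (X i * pderiv i f) + 2 * f := by
    have pderiv_two : pderiv i (2 : MvPolynomial (Fin d) ℝ) = 0 := Derivation.map_natCast _ 2
    simp only [pderiv_mul, map_add, pderiv_normSqPoly, pderiv_X_self, pderiv_two]
    ring
  simp only [laplacian, LinearMap.sum_apply, LinearMap.comp_apply, Derivation.coeFn_coe,
    second_pderiv, Finset.sum_add_distrib, ← Finset.mul_sum, hf.sum_X_mul_pderiv,
    Finset.sum_const, Finset.card_univ, Fintype.card_fin, nsmul_eq_mul, smul_eq_C_mul, map_add,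
    map_mul, map_natCast, map_ofNat]
  ring

theorem laplacian_normSqPoly_pow_succ_mul (hf : f.IsHomogeneous m) (j : ℕ) :
    laplacian d (normSqPoly (Fin d) ℝ ^ (j + 1) * f) =
      normSqPoly (Fin d) ℝ ^ (j + 1) * laplacian d f +
        (2 * (j + 1) * (2 * j + 2 * m + d) : ℝ) • (normSqPoly (Fin d) ℝ ^ j * f) := by
  induction j with
  | zero =>
    rw [zero_add, pow_one, laplacian_normSqPoly_mul hf, pow_zero, one_mul]
    congr 2
    push_cast
    ring
  | succ j ih =>
    rw [pow_succ', mul_assoc,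
      laplacian_normSqPoly_mul ((isHomogeneous_normSqPoly.pow (j + 1)).mul hf), ih]
    simp only [smul_eq_C_mul, map_add, map_mul, map_natCast, map_ofNat, map_one, Nat.cast_add,
      Nat.cast_mul, Nat.cast_ofNat, Nat.cast_one]
    ring

end Laplacian

theorem expand_contract_two_of_even {R : Type*} [CommRing R] [NoZeroDivisors R] [CharZero R]
    {p : Polynomial R} (hp : p.comp (Polynomial.C (-1) * Polynomial.X) = p) :
    Polynomial.expand R 2 (Polynomial.contract 2 p) = p := by
  ext m
  rw [Polynomial.coeff_expand two_pos, Polynomial.coeff_contract two_ne_zero]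
  split_ifs with hm
  · rw [Nat.div_mul_cancel hm]
  · have odd_m : Odd m := Nat.not_even_iff_odd.1 (even_iff_two_dvd.not.2 hm)
    have hcoeff := congrArg (Polynomial.coeff · m) hp
    simp only [Polynomial.comp_C_mul_X_coeff, odd_m.neg_one_pow, mul_neg_one] at hcoeff
    exact (self_eq_neg.1 hcoeff.symm).symm

section Zonal

variable {ι : Type*} [Fintype ι]

/-- The zonal polynomials with axis `k`: the polynomial functions whose value at `x` depends only
on `x k` and on the length of `x`. -/
def zonalSubalgebra (k : ι) : Subalgebra ℝ (MvPolynomial ι ℝ) where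
  carrier := {f | ∀ x y : ι → ℝ, x k = y k → x ⬝ᵥ x = y ⬝ᵥ y → eval x f = eval y f}
  mul_mem' hf hg x y hk h := by rw [map_mul, map_mul, hf x y hk h, hg x y hk h]
  add_mem' hf hg x y hk h := by rw [map_add, map_add, hf x y hk h, hg x y hk h]
  algebraMap_mem' a x y _ _ := by rw [algebraMap_eq, eval_C, eval_C]

theorem X_mem_zonalSubalgebra (k : ι) : X k ∈ zonalSubalgebra k :=
  fun x y hk _ => by rw [eval_X, eval_X, hk]

theorem normSqPoly_mem_zonalSubalgebra (k : ι) : normSqPoly ι ℝ ∈ zonalSubalgebra k :=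
  fun x y _ h => by rw [eval_normSqPoly, eval_normSqPoly, h]

variable [DecidableEq ι] {n : ℕ} {i k : ι} {f : MvPolynomial ι ℝ}

theorem smul_single_add_smul_single_dotProduct_self (hik : i ≠ k) (a b : ℝ) :
    (a • Pi.single i 1 + b • Pi.single k 1 : ι → ℝ) ⬝ᵥ (a • Pi.single i 1 + b • Pi.single k 1) =
      a ^ 2 + b ^ 2 := by
  simp only [add_dotProduct, dotProduct_add, smul_dotProduct, dotProduct_smul,
    single_one_dotProduct, Pi.single_eq_same, Pi.single_eq_of_ne hik, Pi.single_eq_of_ne hik.symm,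
    smul_eq_mul]
  ring

theorem exists_polynomial_eval_sq_of_mem_zonalSubalgebra (hik : i ≠ k) (hf : f.IsHomogeneous n)
    (hz : f ∈ zonalSubalgebra k) :
    ∃ q : Polynomial ℝ, q.natDegree ≤ n / 2 ∧
      ∀ t : ℝ, q.eval (t ^ 2) = eval (t • Pi.single i 1 + Pi.single k 1) f := by
  let p : Polynomial ℝ := aeval (fun l => Polynomial.C ((Pi.single i 1 : ι → ℝ) l) * Polynomial.X +
    Polynomial.C ((Pi.single k 1 : ι → ℝ) l)) f
  have eval_p (t : ℝ) : p.eval t = eval (t • Pi.single i 1 + Pi.single k 1) f := by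
    rw [← Polynomial.coe_aeval_eq_eval, comp_aeval_apply, aeval_eq_eval]
    refine congrArg (eval · f) (funext fun l => ?_)
    simp [mul_comm t]
  have even_p : p.comp (Polynomial.C (-1) * Polynomial.X) = p := by
    refine Polynomial.funext fun t => ?_
    rw [Polynomial.eval_comp, eval_p, eval_p]
    refine hz _ _ ?_ ?_
    · simp [hik.symm]
    · have h := smul_single_add_smul_single_dotProduct_self hik
      simpa using (h (-t) 1).trans (((congrArg (· + _) (neg_sq t)).trans (h t 1).symm))
  have natDegree_p : p.natDegree ≤ n * 1 :=
    aeval_natDegree_le f hf.totalDegree_le _ fun _ => Polynomial.natDegree_linear_le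
  refine ⟨Polynomial.contract 2 p, ?_, fun t => ?_⟩
  · rw [← expand_contract_two_of_even even_p, Polynomial.natDegree_expand] at natDegree_p
    omega
  · rw [← eval_p, ← Polynomial.expand_eval, expand_contract_two_of_even even_p]

omit [DecidableEq ι] in
theorem exists_eq_sum_of_mem_zonalSubalgebra (hik : i ≠ k) (hf : f.IsHomogeneous n)
    (hz : f ∈ zonalSubalgebra k) :
    ∃ c : ℕ → ℝ, f = ∑ j ∈ Finset.range (n / 2 + 1),
      C (c j) * ((normSqPoly ι ℝ - X k ^ 2) ^ j * X k ^ (n - 2 * j)) := by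
  classical
  obtain ⟨q, natDegree_q, eval_q⟩ :=
    exists_polynomial_eval_sq_of_mem_zonalSubalgebra hik hf hz
  refine ⟨q.coeff, MvPolynomial.funext_set (fun _ => {0}ᶜ)
    (fun _ => (Set.finite_singleton 0).infinite_compl) fun x hx => ?_⟩
  have hxk : x k ≠ 0 := hx k trivial
  have sq_le : x k ^ 2 ≤ x ⬝ᵥ x := by
    rw [sq]
    exact Finset.single_le_sum (fun l _ => mul_self_nonneg (x l)) (Finset.mem_univ k)
  let s := √(x ⬝ᵥ x - x k ^ 2)
  have s_sq : s ^ 2 = x ⬝ᵥ x - x k ^ 2 := Real.sq_sqrt (sub_nonneg.2 sq_le)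
  calc eval x f = eval (s • Pi.single i 1 + x k • Pi.single k 1) f := by
        refine hz _ _ ?_ ?_
        · simp [hik.symm]
        · rw [smul_single_add_smul_single_dotProduct_self hik, s_sq, sub_add_cancel]
    _ = eval (x k • ((s / x k) • Pi.single i 1 + Pi.single k 1)) f := by
        rw [smul_add, smul_smul, mul_div_cancel₀ s hxk]
    _ = x k ^ n * q.eval ((s / x k) ^ 2) := by rw [eval_smul_of_isHomogeneous hf, eval_q]
    _ = ∑ j ∈ Finset.range (n / 2 + 1), q.coeff j * ((s ^ 2) ^ j * x k ^ (n - 2 * j)) := by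
        rw [Polynomial.eval_eq_sum_range' (Nat.lt_succ_of_le natDegree_q), Finset.mul_sum]
        refine Finset.sum_congr rfl fun j hj => ?_
        obtain ⟨m, rfl⟩ : ∃ m, n = 2 * j + m :=
          Nat.exists_eq_add_of_le (by have := Finset.mem_range.1 hj; omega)
        rw [Nat.add_sub_cancel_left, pow_add, pow_mul, div_pow, div_pow]
        field_simp
    _ = _ := by
        simp only [map_sum, map_mul, map_pow, map_sub, eval_C, eval_X, eval_normSqPoly, s_sq]

end Zonal

section ZonalHarmonics

variable {d n : ℕ} {k : Fin d} {f g : MvPolynomial (Fin d) ℝ}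

theorem fischer_normSqPoly_sub_pow_mul (hf : laplacian d f = 0) (p g : MvPolynomial (Fin d) ℝ)
    (j : ℕ) : fischer ((normSqPoly (Fin d) ℝ - p) ^ j * g) f = fischer ((-p) ^ j * g) f := by
  induction j generalizing g with
  | zero => rw [pow_zero, pow_zero]
  | succ j ih =>
    calc fischer ((normSqPoly (Fin d) ℝ - p) ^ (j + 1) * g) f
        = fischer (normSqPoly (Fin d) ℝ * ((normSqPoly (Fin d) ℝ - p) ^ j * g)) f +
          fischer ((normSqPoly (Fin d) ℝ - p) ^ j * (-p * g)) f := by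
            rw [← LinearMap.add_apply, ← map_add]
            ring_nf
      _ = fischer ((-p) ^ (j + 1) * g) f := by
            rw [fischer_normSqPoly_mul, hf, map_zero, zero_add, ih, pow_succ, mul_assoc]

theorem eq_zero_of_zonal_of_eval_eq_zero (hf : f ∈ harmonics d n) (hz : f ∈ zonalSubalgebra k)
    (h : eval (Pi.single k 1) f = 0) : f = 0 := by
  obtain ⟨homogeneous, harmonic⟩ := hf
  cases subsingleton_or_nontrivial (Fin d) with
  | inl _ => exact eq_zero_of_subsingleton homogeneous h
  | inr _ =>
    obtain ⟨i, hik⟩ := exists_ne k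
    obtain ⟨c, hc⟩ := exists_eq_sum_of_mem_zonalSubalgebra hik homogeneous hz
    have term_eq_zero (j : ℕ) (hj : j ∈ Finset.range (n / 2 + 1)) :
        fischer (C (c j) * ((normSqPoly (Fin d) ℝ - X k ^ 2) ^ j * X k ^ (n - 2 * j))) f = 0 := by
      have degree_eq : 2 * j + (n - 2 * j) = n := by
        have := Finset.mem_range.1 hj
        omega
      have power_eq : (-X k ^ 2) ^ j * X k ^ (n - 2 * j) =
          C ((-1) ^ j) * (X k ^ n : MvPolynomial (Fin d) ℝ) := by
        rw [neg_pow, ← pow_mul, mul_assoc, ← pow_add, degree_eq, map_pow, map_neg, map_one]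
      rw [← smul_eq_C_mul, map_smul, LinearMap.smul_apply,
        fischer_normSqPoly_sub_pow_mul harmonic, power_eq, ← smul_eq_C_mul, map_smul,
        LinearMap.smul_apply, fischer_X_pow homogeneous, h, mul_zero, smul_zero, smul_zero]
    apply eq_zero_of_fischer_self
    nth_rewrite 1 [hc]
    rw [map_sum, LinearMap.sum_apply, Finset.sum_eq_zero term_eq_zero]

theorem exists_eq_smul_of_zonal (hf : f ∈ harmonics d n) (hfz : f ∈ zonalSubalgebra k)
    (hg : g ∈ harmonics d n) (hgz : g ∈ zonalSubalgebra k) (hg0 : g ≠ 0) :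
    ∃ c : ℝ, f = c • g := by
  have eval_g : eval (Pi.single k 1) g ≠ 0 :=
    fun h => hg0 (eq_zero_of_zonal_of_eval_eq_zero hg hgz h)
  set c := eval (Pi.single k 1) f / eval (Pi.single k 1) g with hc
  refine ⟨c, sub_eq_zero.1 (eq_zero_of_zonal_of_eval_eq_zero (k := k)
    (sub_mem hf ((harmonics d n).smul_mem c hg)) (sub_mem hfz (Subalgebra.smul_mem _ hgz c)) ?_)⟩
  rw [map_sub, smul_eval, hc, div_mul_cancel₀ _ eval_g, sub_self]

end ZonalHarmonics

section Irreducibility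

variable {d n : ℕ} {k : Fin d}

instance finiteDimensional_harmonics : FiniteDimensional ℝ (harmonics d n) :=
  have : FiniteDimensional ℝ (homogeneousSubmodule (Fin d) ℝ n) :=
    Module.Finite.iff_fg.2 (homogeneousSubmodule_fg (R := ℝ) (σ := Fin d) n)
  Submodule.finiteDimensional_of_le inf_le_left

theorem fischer_harmonicRep (Q : specialOrthogonalGroup (Fin d) ℝ) (f g : harmonics d n) :
    fischer (harmonicRep d n Q f : MvPolynomial (Fin d) ℝ) g =
      fischer (f : MvPolynomial (Fin d) ℝ)
        (harmonicRep d n Q⁻¹ g : MvPolynomial (Fin d) ℝ) :=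
  fischer_compMatrix _ _ _

-- With `e = √(x ⬝ᵥ x) • e_k`, the value `u (Q e) = |e|ⁿ ⟨u, Q⁻¹ u⟩` does not change when `Q` is
-- replaced by its inverse, and some rotation satisfies both `Q e = y` and `Q⁻¹ e = x`.
theorem representer_mem_zonalSubalgebra {U : Submodule ℝ (harmonics d n)}
    (hU : ∀ Q : specialOrthogonalGroup (Fin d) ℝ, ∀ f ∈ U, harmonicRep d n Q f ∈ U)
    {u : harmonics d n} (hu : u ∈ U)
    (hrep : ∀ f ∈ U, fischer (u : MvPolynomial (Fin d) ℝ) (f : MvPolynomial (Fin d) ℝ) =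
      eval (Pi.single k 1) (f : MvPolynomial (Fin d) ℝ)) :
    (u : MvPolynomial (Fin d) ℝ) ∈ zonalSubalgebra k := by
  intro x y hk hlen
  obtain rfl | hxy := eq_or_ne x y
  · rfl
  have hinner : (√(x ⬝ᵥ x) • Pi.single k 1) ⬝ᵥ x = (√(x ⬝ᵥ x) • Pi.single k 1) ⬝ᵥ y := by
    rw [smul_dotProduct, smul_dotProduct, single_one_dotProduct, single_one_dotProduct, hk]
  have hnorm := sqrt_smul_single_dotProduct_self k x
  obtain ⟨Q, hQy, hQx⟩ := exists_rotation_swap hnorm (hnorm.trans hlen) hinner hxy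
  have eval_rotation (P : specialOrthogonalGroup (Fin d) ℝ) :
      eval ((P : Matrix (Fin d) (Fin d) ℝ) *ᵥ (√(x ⬝ᵥ x) • Pi.single k 1))
          (u : MvPolynomial (Fin d) ℝ) =
        √(x ⬝ᵥ x) ^ n * fischer (u : MvPolynomial (Fin d) ℝ)
          (harmonicRep d n P⁻¹ u : MvPolynomial (Fin d) ℝ) := by
    rw [hrep _ (hU P⁻¹ u hu), eval_harmonicRep, inv_inv, mulVec_smul,
      eval_smul_of_isHomogeneous u.2.1]
  symm
  calc eval y (u : MvPolynomial (Fin d) ℝ)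
      = √(x ⬝ᵥ x) ^ n * fischer (u : MvPolynomial (Fin d) ℝ)
          (harmonicRep d n Q⁻¹ u : MvPolynomial (Fin d) ℝ) := by rw [← hQy, eval_rotation]
    _ = √(x ⬝ᵥ x) ^ n * fischer (u : MvPolynomial (Fin d) ℝ)
          (harmonicRep d n Q⁻¹⁻¹ u : MvPolynomial (Fin d) ℝ) := by
        rw [← fischer_harmonicRep, fischer_isSymm.eq, inv_inv]
    _ = eval x (u : MvPolynomial (Fin d) ℝ) := by
        rw [← eval_rotation, ← hQx, inv_mulVec_mulVec]

theorem exists_zonal_mem (k : Fin d) {U : Submodule ℝ (harmonics d n)}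
    (hU : ∀ Q : specialOrthogonalGroup (Fin d) ℝ, ∀ f ∈ U, harmonicRep d n Q f ∈ U)
    (hne : U ≠ ⊥) : ∃ u ∈ U, u ≠ 0 ∧ (u : MvPolynomial (Fin d) ℝ) ∈ zonalSubalgebra k := by
  obtain ⟨u, hu, hrep⟩ := exists_mem_forall_apply_eq (B := fischer.restrict (harmonics d n))
    (fun v hv => Subtype.ext (eq_zero_of_fischer_self hv)) U
    ((aeval (Pi.single k 1)).toLinearMap ∘ₗ (harmonics d n).subtype)
  refine ⟨u, hu, ?_, representer_mem_zonalSubalgebra hU hu hrep⟩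
  rintro rfl
  obtain ⟨f, hf, hf0⟩ := Submodule.exists_mem_ne_zero_of_ne_bot hne
  refine hf0 (Subtype.ext (eq_zero_of_forall_eval_rotation (k := k) f.2.1 fun Q => ?_))
  rw [← inv_inv Q, ← eval_harmonicRep]
  exact (hrep _ (hU Q⁻¹ f hf)).symm.trans (LinearMap.congr_fun (map_zero fischer) _)

theorem eq_bot_or_eq_top_of_invariant (hd : 1 ≤ d) {U : Submodule ℝ (harmonics d n)}
    (hU : ∀ Q : specialOrthogonalGroup (Fin d) ℝ, ∀ f ∈ U, harmonicRep d n Q f ∈ U) :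
    U = ⊥ ∨ U = ⊤ := by
  by_contra! ⟨hbot, htop⟩
  let B : LinearMap.BilinForm ℝ (harmonics d n) := fischer.restrict (harmonics d n)
  have compl : IsCompl U (B.orthogonal U) :=
    isCompl_orthogonal_of_anisotropic (fischer_isSymm.restrict _).isRefl
      (fun v hv => Subtype.ext (eq_zero_of_fischer_self hv)) U
  have orthogonal_invariant (Q : specialOrthogonalGroup (Fin d) ℝ) (f : harmonics d n)
      (hf : f ∈ B.orthogonal U) : harmonicRep d n Q f ∈ B.orthogonal U := by
    intro g hg
    have adjoint : B (harmonicRep d n Q⁻¹ g) f = B g (harmonicRep d n Q⁻¹⁻¹ f) :=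
      fischer_harmonicRep Q⁻¹ g f
    rw [inv_inv] at adjoint
    exact adjoint.symm.trans (hf _ (hU Q⁻¹ g hg))
  have orthogonal_ne_bot : B.orthogonal U ≠ ⊥ := fun h => htop (by simpa [h] using compl.sup_eq_top)
  let k : Fin d := ⟨0, hd⟩
  obtain ⟨u, hu, hu0, u_zonal⟩ := exists_zonal_mem k hU hbot
  obtain ⟨v, hv, hv0, v_zonal⟩ := exists_zonal_mem k orthogonal_invariant orthogonal_ne_bot
  obtain ⟨c, hc⟩ := exists_eq_smul_of_zonal v.2 v_zonal u.2 u_zonal (Subtype.coe_ne_coe.2 hu0)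
  have hvU : v ∈ U := (Subtype.ext hc : v = c • u) ▸ U.smul_mem c hu
  exact hv0 (Submodule.disjoint_def.1 compl.disjoint v hvU hv)

theorem isIrreducible_harmonicRep (hd : 1 ≤ d) [Nontrivial (harmonics d n)] :
    (harmonicRep d n).IsIrreducible := by
  have : Nontrivial (Subrepresentation (harmonicRep d n)) := by
    refine ⟨⟨⊥, ⊤, fun h => bot_ne_top (α := Submodule ℝ (harmonics d n)) ?_⟩⟩
    exact congrArg Subrepresentation.toSubmodule h
  refine ⟨fun U => ?_⟩
  exact (eq_bot_or_eq_top_of_invariant hd U.apply_mem_toSubmodule).imp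
    (fun h => Subrepresentation.toSubmodule_injective h)
    (fun h => Subrepresentation.toSubmodule_injective h)

end Irreducibility

section Gegenbauer

variable {d n : ℕ} {k : Fin d} {lam : ℝ}

/-- The coefficient of `t ^ (n - 2 * j)` in the Gegenbauer polynomial of degree `n`, divided by
the leading coefficient. Unlike the Gegenbauer polynomial itself, this normalization does not
degenerate for `lam = 0`, the parameter that belongs to the dimension `2`. -/
def gegenbauerCoeff (n : ℕ) (lam : ℝ) (j : ℕ) : ℝ :=
  (ascPochhammer ℝ j).eval (-(n : ℝ) / 2) * (ascPochhammer ℝ j).eval ((1 - (n : ℝ)) / 2) /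
    ((ascPochhammer ℝ j).eval (1 - (n : ℝ) - lam) * (j ! : ℝ))

/-- The leading coefficient `(lam)_n 2^n / n!` of the Gegenbauer polynomial of degree `n`. -/
def gegenbauerLeadingCoeff (n : ℕ) (lam : ℝ) : ℝ :=
  (ascPochhammer ℝ n).eval lam * 2 ^ n / (n ! : ℝ)

/-- The homogeneous polynomial `‖x‖ⁿ p (x_k / ‖x‖)`, where `p` is the Gegenbauer polynomial of
degree `n` divided by its leading coefficient. -/
def zonalPoly (k : Fin d) (n : ℕ) (lam : ℝ) : MvPolynomial (Fin d) ℝ :=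
  ∑ j ∈ Finset.range (n / 2 + 1),
    gegenbauerCoeff n lam j • (normSqPoly (Fin d) ℝ ^ j * X k ^ (n - 2 * j))

theorem gegenbauerCoeff_zero (n : ℕ) (lam : ℝ) : gegenbauerCoeff n lam 0 = 1 := by
  simp [gegenbauerCoeff]

theorem gegenbauerLeadingCoeff_pos (n : ℕ) (hlam : 0 < lam) : 0 < gegenbauerLeadingCoeff n lam :=
  div_pos (mul_pos (ascPochhammer_pos n lam hlam) (by positivity)) (by positivity)

theorem gegenbauerCoeff_succ (hlam : -1 < lam) {j : ℕ} (hj : 2 * (j + 1) ≤ n) :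
    gegenbauerCoeff n lam j * ((n - 2 * j) * (n - 2 * j - 1)) =
      -(gegenbauerCoeff n lam (j + 1) * (4 * (j + 1) * (n - j - 1 + lam))) := by
  have denom_ne_zero {i : ℕ} (hi : i ≤ j) : 1 - (n : ℝ) - lam + i ≠ 0 := by
    have hjn : 2 * ((j : ℝ) + 1) ≤ n := by exact_mod_cast hj
    have hij : (i : ℝ) ≤ j := by exact_mod_cast hi
    exact ne_of_lt (by linarith [j.cast_nonneg (α := ℝ)])
  have pochhammer_ne_zero : (ascPochhammer ℝ j).eval (1 - (n : ℝ) - lam) ≠ 0 := by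
    rw [Ne, ascPochhammer_eval_eq_zero_iff]
    rintro ⟨i, hi, h⟩
    exact denom_ne_zero hi.le (by rw [h, add_neg_cancel])
  have last_ne_zero := denom_ne_zero le_rfl
  have factorial_ne_zero : (j ! : ℝ) ≠ 0 := Nat.cast_ne_zero.2 j.factorial_ne_zero
  simp only [gegenbauerCoeff, ascPochhammer_succ_eval, Nat.factorial_succ, Nat.cast_mul,
    Nat.cast_add, Nat.cast_one]
  field_simp
  ring

theorem laplacian_zonalPoly_term (k : Fin d) {j : ℕ} (hj : 2 * (j + 1) ≤ n) :
    gegenbauerCoeff n ((d - 2) / 2) (j + 1) •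
        laplacian d (normSqPoly (Fin d) ℝ ^ (j + 1) * X k ^ (n - 2 * (j + 1))) =
      gegenbauerCoeff n ((d - 2) / 2) (j + 1) •
          (normSqPoly (Fin d) ℝ ^ (j + 1) * laplacian d (X k ^ (n - 2 * (j + 1)))) -
        gegenbauerCoeff n ((d - 2) / 2) j •
          (normSqPoly (Fin d) ℝ ^ j * laplacian d (X k ^ (n - 2 * j))) := by
  have d_pos : (0 : ℝ) < d := Nat.cast_pos.2 k.pos
  have recurrence := gegenbauerCoeff_succ (lam := ((d : ℝ) - 2) / 2) (by linarith) hj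
  have cast_sub : ((n - 2 * j : ℕ) : ℝ) = n - 2 * j := by
    rw [Nat.cast_sub (by omega), Nat.cast_mul, Nat.cast_ofNat]
  have cast_sub_succ : ((n - 2 * (j + 1) : ℕ) : ℝ) = n - 2 * (j + 1) := by
    rw [Nat.cast_sub hj, Nat.cast_mul, Nat.cast_ofNat, Nat.cast_succ]
  rw [laplacian_normSqPoly_pow_succ_mul (isHomogeneous_X_pow k _), laplacian_X_pow k (n - 2 * j),
    cast_sub, cast_sub_succ, Nat.sub_sub, ← mul_add_one, smul_add, mul_smul_comm, smul_smul,
    smul_smul, recurrence, neg_smul, sub_neg_eq_add]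
  congr 2
  ring

theorem zonalPoly_mem_harmonics (k : Fin d) (n : ℕ) :
    zonalPoly k n ((d - 2) / 2) ∈ harmonics d n := by
  refine ⟨Submodule.sum_mem _ fun j hj => Submodule.smul_mem _ _ ?_, ?_⟩
  · have degree_eq : 2 * j + (n - 2 * j) = n := by
      have := Finset.mem_range.1 hj
      omega
    have homogeneous := ((isHomogeneous_normSqPoly (σ := Fin d) (R := ℝ)).pow j).mul
      (isHomogeneous_X_pow k (n - 2 * j))
    rwa [degree_eq] at homogeneous
  · let T (j : ℕ) : MvPolynomial (Fin d) ℝ := gegenbauerCoeff n ((d - 2) / 2) j •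
      (normSqPoly (Fin d) ℝ ^ j * laplacian d (X k ^ (n - 2 * j)))
    have T_last : T (n / 2) = 0 := by
      obtain h | h : n - 2 * (n / 2) = 0 ∨ n - 2 * (n / 2) = 1 := by omega
      all_goals simp [T, h, laplacian_X_pow]
    have T_zero : gegenbauerCoeff n ((d - 2) / 2) 0 •
        laplacian d (normSqPoly (Fin d) ℝ ^ 0 * X k ^ (n - 2 * 0)) = T 0 := by
      simp only [T, pow_zero, one_mul]
    change laplacian d (zonalPoly k n ((d - 2) / 2)) = 0
    calc laplacian d (zonalPoly k n ((d - 2) / 2))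
        = ∑ j ∈ Finset.range (n / 2), (T (j + 1) - T j) + T 0 := by
          simp only [zonalPoly, map_sum, map_smul]
          rw [Finset.sum_range_succ', T_zero]
          refine congrArg (· + T 0) (Finset.sum_congr rfl fun j hj => ?_)
          exact laplacian_zonalPoly_term k (by have := Finset.mem_range.1 hj; omega)
      _ = 0 := by rw [Finset.sum_range_sub, T_last, zero_sub, neg_add_cancel]

theorem zonalPoly_mem_zonalSubalgebra (k : Fin d) (n : ℕ) (lam : ℝ) :
    zonalPoly k n lam ∈ zonalSubalgebra k :=
  Subalgebra.sum_mem _ fun _ _ => Subalgebra.smul_mem _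
    (mul_mem (pow_mem (normSqPoly_mem_zonalSubalgebra k) _)
      (pow_mem (X_mem_zonalSubalgebra k) _)) _

theorem zonalPoly_ne_zero (hd : 2 ≤ d) (k : Fin d) (n : ℕ) (lam : ℝ) : zonalPoly k n lam ≠ 0 := by
  have : Nontrivial (Fin d) := Fin.nontrivial_iff_two_le.2 hd
  obtain ⟨i, hik⟩ := exists_ne k
  let z : Fin d → ℂ := Pi.single k 1 + Pi.single i Complex.I
  have z_k : z k = 1 := by simp [z, hik.symm]
  have z_isotropic : aeval z (normSqPoly (Fin d) ℝ) = 0 := by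
    have hz : aeval z (normSqPoly (Fin d) ℝ) = z ⬝ᵥ z := by
      simp only [normSqPoly, map_sum, map_pow, aeval_X, dotProduct, ← pow_two]
    simp [hz, z, hik, hik.symm]
  have aeval_zonalPoly : aeval z (zonalPoly k n lam) = 1 := by
    rw [zonalPoly, Finset.sum_range_succ']
    simp [z_isotropic, z_k, gegenbauerCoeff_zero]
  intro h
  rw [h, map_zero] at aeval_zonalPoly
  exact zero_ne_one aeval_zonalPoly

theorem nontrivial_harmonics (hd : 2 ≤ d) (n : ℕ) : Nontrivial (harmonics d n) :=
  let k : Fin d := ⟨0, by omega⟩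
  ⟨⟨_, zonalPoly_mem_harmonics k n⟩, 0, fun h =>
    zonalPoly_ne_zero hd k n _ (congrArg Subtype.val h)⟩

theorem eval_smul_zonalPoly (k : Fin d) (n : ℕ) (lam : ℝ) {x : EuclideanSpace ℝ (Fin d)}
    (hx : x ≠ 0) : eval (fun i => x i) (gegenbauerLeadingCoeff n lam • zonalPoly k n lam) =
      ‖x‖ ^ n * (gegenbauer n lam).eval (x k / ‖x‖) := by
  have norm_sq : (fun i => x i) ⬝ᵥ (fun i => x i) = ‖x‖ ^ 2 := by
    simp only [EuclideanSpace.real_norm_sq_eq, dotProduct, ← pow_two]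
  rw [smul_eval, zonalPoly, gegenbauer, map_sum, Polynomial.eval_finsetSum, Finset.mul_sum,
    Finset.mul_sum]
  refine Finset.sum_congr rfl fun j hj => ?_
  obtain ⟨m, hm⟩ : ∃ m, n = 2 * j + m :=
    Nat.exists_eq_add_of_le (by have := Finset.mem_range.1 hj; omega)
  rw [Polynomial.eval_monomial, ← gegenbauerCoeff, ← gegenbauerLeadingCoeff, smul_eval, map_mul,
    map_pow, map_pow, eval_normSqPoly, eval_X, norm_sq, ← pow_mul, div_pow,
    show n - 2 * j = m by omega, show ‖x‖ ^ n = ‖x‖ ^ (2 * j) * ‖x‖ ^ m by rw [hm, pow_add]]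
  field_simp

end Gegenbauer

section Stabilizer

variable {d n : ℕ} {k : Fin d}

theorem forall_stabilizer_iff_mem_zonalSubalgebra (hd : 3 ≤ d) (Y : harmonics d n) :
    (∀ Q : specialOrthogonalGroup (Fin d) ℝ,
      (Q : Matrix (Fin d) (Fin d) ℝ) *ᵥ Pi.single k 1 = Pi.single k 1 → harmonicRep d n Q Y = Y) ↔
      (Y : MvPolynomial (Fin d) ℝ) ∈ zonalSubalgebra k := by
  constructor
  · intro hY x y hk hlen
    obtain ⟨Q, hQx, hQk⟩ := exists_rotation (κ := Unit)
      (by rw [Fintype.card_unit, Fintype.card_fin]; omega) (fun _ => Pi.single k 1) hlen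
      (by simpa only [single_one_dotProduct, forall_const])
    calc eval x (Y : MvPolynomial (Fin d) ℝ)
        = eval y (harmonicRep d n Q Y : MvPolynomial (Fin d) ℝ) := by
          rw [eval_harmonicRep, ← hQx, inv_mulVec_mulVec]
      _ = eval y (Y : MvPolynomial (Fin d) ℝ) := by rw [hY Q (hQk ())]
  · intro hY Q hQ
    have inv_fix : ((Q⁻¹ : specialOrthogonalGroup (Fin d) ℝ) : Matrix (Fin d) (Fin d) ℝ) *ᵥ
        Pi.single k 1 = Pi.single k 1 := by
      conv_lhs => rw [← hQ, inv_mulVec_mulVec]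
    refine Subtype.ext (MvPolynomial.funext fun x => ?_)
    rw [eval_harmonicRep]
    refine hY _ _ ?_ (mulVec_dotProduct_mulVec Q⁻¹ x x)
    simpa only [inv_fix, single_one_dotProduct] using
      mulVec_dotProduct_mulVec Q⁻¹ (Pi.single k 1) x

theorem mem_zonalSubalgebra_iff_exists_smul_zonalPoly (hd : 3 ≤ d) {f : MvPolynomial (Fin d) ℝ}
    (hf : f ∈ harmonics d n) : f ∈ zonalSubalgebra k ↔
      ∃ c : ℝ, f = c • (gegenbauerLeadingCoeff n ((d - 2) / 2) •
        zonalPoly k n ((d - 2) / 2)) := by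
  have lam_pos : (0 : ℝ) < (d - 2) / 2 := by
    have : (3 : ℝ) ≤ d := by exact_mod_cast hd
    linarith
  have zonal := (zonalSubalgebra k).smul_mem (zonalPoly_mem_zonalSubalgebra k n ((d - 2) / 2))
    (gegenbauerLeadingCoeff n ((d - 2) / 2))
  constructor
  · intro hz
    exact exists_eq_smul_of_zonal hf hz
      ((harmonics d n).smul_mem _ (zonalPoly_mem_harmonics k n)) zonal
      (smul_ne_zero (gegenbauerLeadingCoeff_pos n lam_pos).ne'
        (zonalPoly_ne_zero (by omega) k n _))
  · rintro ⟨c, rfl⟩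
    exact (zonalSubalgebra k).smul_mem zonal c

theorem eq_smul_zonalPoly_iff (k : Fin d) (n : ℕ) (lam c : ℝ) {f : MvPolynomial (Fin d) ℝ} :
    f = c • (gegenbauerLeadingCoeff n lam • zonalPoly k n lam) ↔
      ∀ x : EuclideanSpace ℝ (Fin d), x ≠ 0 →
        eval (fun i => x i) f = c * ‖x‖ ^ n * (gegenbauer n lam).eval (x k / ‖x‖) := by
  have eval_smul {x : EuclideanSpace ℝ (Fin d)} (hx : x ≠ 0) :
      eval (fun i => x i) (c • (gegenbauerLeadingCoeff n lam • zonalPoly k n lam)) =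
        c * ‖x‖ ^ n * (gegenbauer n lam).eval (x k / ‖x‖) := by
    rw [smul_eval, eval_smul_zonalPoly k n lam hx, mul_assoc]
  have : Nonempty (Fin d) := ⟨k⟩
  refine ⟨fun h x hx => h ▸ eval_smul hx, fun h => eq_of_forall_ne_zero_eval_eq fun x hx => ?_⟩
  have toLp_ne_zero : WithLp.toLp 2 x ≠ 0 := (WithLp.toLp_eq_zero 2).not.2 hx
  exact (h _ toLp_ne_zero).trans (eval_smul toLp_ne_zero).symm

end Stabilizer

end SphericalHarmonics

end

open SphericalHarmonics in
theorem mainTheorem7 :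
    -- the representation on the harmonics has only the trivial invariant subspaces
    (∀ d n : ℕ, 1 ≤ d → ∀ U : Submodule ℝ (harmonics d n),
      (∀ Q : Matrix.specialOrthogonalGroup (Fin d) ℝ, ∀ f ∈ U, harmonicRep d n Q f ∈ U) →
        U = ⊥ ∨ U = ⊤) ∧
    -- for `d ≥ 2` the space is moreover nonzero, so the representation is irreducible
    (∀ d n : ℕ, 2 ≤ d → (harmonicRep d n).IsIrreducible) ∧
    -- the harmonics that are invariant under all rotations fixing the last basis vector
    (∀ (d n : ℕ) (hd : 3 ≤ d),
      (∃ Z : harmonics d n, ∀ x : EuclideanSpace ℝ (Fin d), x ≠ 0 →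
        MvPolynomial.eval (fun i => x i) (Z : MvPolynomial (Fin d) ℝ) =
          ‖x‖ ^ n * (gegenbauer n (((d : ℝ) - 2) / 2)).eval (x ⟨d - 1, by omega⟩ / ‖x‖)) ∧
      (∀ Y : harmonics d n,
        (∀ Q : Matrix.specialOrthogonalGroup (Fin d) ℝ,
          (Q : Matrix (Fin d) (Fin d) ℝ).mulVec (Pi.single ⟨d - 1, by omega⟩ 1) =
              Pi.single ⟨d - 1, by omega⟩ 1 →
            harmonicRep d n Q Y = Y) ↔
        ∃ c : ℝ, ∀ x : EuclideanSpace ℝ (Fin d), x ≠ 0 →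
          MvPolynomial.eval (fun i => x i) (Y : MvPolynomial (Fin d) ℝ) =
            c * ‖x‖ ^ n *
              (gegenbauer n (((d : ℝ) - 2) / 2)).eval (x ⟨d - 1, by omega⟩ / ‖x‖))) := by
  refine ⟨fun d n hd U hU => eq_bot_or_eq_top_of_invariant hd hU, fun d n hd => ?_,
    fun d n hd => ⟨?_, fun Y => ?_⟩⟩
  · have := nontrivial_harmonics hd n
    exact isIrreducible_harmonicRep (by omega)
  · exact ⟨⟨_, (harmonics d n).smul_mem _ (zonalPoly_mem_harmonics _ n)⟩,
      fun x hx => eval_smul_zonalPoly _ n _ hx⟩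
  · rw [forall_stabilizer_iff_mem_zonalSubalgebra hd,
      mem_zonalSubalgebra_iff_exists_smul_zonalPoly hd Y.2]
    exact exists_congr fun c => eq_smul_zonalPoly_iff _ n _ c
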